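/- **Theorem 5.1.** Let $r_1,r_2\ge 1$ and let $\mathcal X=\{1,\dots,r_1\}\times\{1,\dots,r_2\}$ carry the componentwise order $\preceq$. A function $f:\mathcal X\to\mathbb R$ is *isotonic* (bimonotone increasing) on a subset of $\mathcal X$ if $f(x)\le f(x')$ for all points $x\preceq x'$ of the subset. Let $\mathring g:\mathcal X\to\mathbb R$ be isotonic, let $x_1,x_2,\dots\in\mathcal X$ be deterministic design points, and let $$Y_i=\mathring g(x_i)+\varepsilon_i,\qquad i=1,2,\dots,$$ where $\varepsilon_1,\varepsilon_2,\dots$ are independent identically distributed real random variables with $\mathbb E[\varepsilon_i]=0$ and $\mathrm{Var}[\varepsilon_i]=\sigma^2<\infty$. For $x\in\mathcal X$ put $$w^{(n)}_x=\frac1n\sum_{i=1}^n 1\{x_i=x\},\qquad \hat g_n(x)=\frac{\sum_{i=1}^n Y_i\,1\{x_i=x\}}{\sum_{i=1}^n 1\{x_i=x\}}$$ (with $\hat g_n(x)=0$ if $x$ is not among $x_1,\dots,x_n$), and suppose that $w^{(n)}\to w$ as $n\to\infty$ for a vector $w$ with $w_x>0$ for all $x\in\mathcal X$. Let $\hat g_n^*$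 be a bimonotone least-squares estimator, that is, a random vector that minimises $$\sum_{x\in\mathcal X}\bigl(f(x)-\hat g_n(x)\bigr)^2w^{(n)}_x$$ over all isotonic $f:\mathcal X\to\mathbb R$; the minimiser is unique as soon as every $w_x^{(n)}$ is positive, hence for all large $n$, and for the other $n$ any measurable choice of a minimiser is allowed. The *comparable level sets* of $\mathring g$ are the connected components of the graph on $\mathcal X$ in which two points are joined if they are comparable for $\preceq$ and $\mathring g$ takes the same value at both. For $\theta\in\mathbb R^{\mathcal X}$ let $\varphi^w(\theta)\in\mathbb R^{\mathcal X}$ be the concatenation of the weighted isotonic regressions of $\theta$ over these sets: on each comparable level set $C$, the restriction of $\varphi^w(\theta)$ to $C$ is the unique minimiser of $\sum_{x\in C}(f(x)-\theta(x))^2w_x$ over all isotonic $f:C\to\mathbb R$. Let $Y_{0,\Sigma}$ be a Gaussian vector in $\mathbb R^{\mathcal X}$ with mean zero and diagonal covariance matrix $\Sigma$, $\Sigma_{xx}=\sigma^2/w_x$. Then $$\sqrt n\,(\hat g_n^*-\mathring g)\ \xrightarrow{\ d\ }\ \varphi^w(Y_{0,\Sigma})\qquad (n\to\infty).$$ -/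

import Mathlib

open MeasureTheory ProbabilityTheory Filter Topology

/-- Weighted least-squares criterion `∑ (f(x) - θ(x))² w(x)`. -/
def weightedSq {X : Type*} [Fintype X] (w θ f : X → ℝ) : ℝ :=
  ∑ x, (f x - θ x) ^ 2 * w x

/-- `f` is an isotonic regression of `θ` with weights `w` over the finite pre-ordered set `X`:
an isotonic function that minimises the weighted least-squares criterion among all isotonic
functions (on a finite set every function is bounded). -/
def IsIsotonicRegression {X : Type*} [Fintype X] [Preorder X] (w θ f : X → ℝ) : Prop :=
  Monotone f ∧ ∀ h : X → ℝ, Monotone h → weightedSq w θ f ≤ weightedSq w θ h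

/-- With positive weights the isotonic regression exists and is unique. -/
theorem existsUnique_isIsotonicRegression {X : Type*} [Fintype X] [Preorder X]
    (w θ : X → ℝ) (hw : ∀ x, 0 < w x) : ∃! f : X → ℝ, IsIsotonicRegression w θ f := by
  have hcont : Continuous (weightedSq w θ) := by
    unfold weightedSq; fun_prop
  have hclosed : IsClosed {f : X → ℝ | Monotone f} := by
    have : {f : X → ℝ | Monotone f} =
        ⋂ (x : X) (y : X) (_ : x ≤ y), {f : X → ℝ | f x ≤ f y} := by
      ext f; simp [Monotone]
    rw [this]
    exact isClosed_iInter fun x => isClosed_iInter fun y => isClosed_iInter fun _ =>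
      isClosed_le (continuous_apply x) (continuous_apply y)
  set C := weightedSq w θ 0 with hC
  have hsub : ∀ f : X → ℝ, weightedSq w θ f ≤ C →
      f ∈ Set.Icc (fun x => θ x - √(C / w x)) (fun x => θ x + √(C / w x)) := by
    intro f hf
    have key : ∀ x, |f x - θ x| ≤ √(C / w x) := by
      intro x
      apply Real.abs_le_sqrt
      rw [le_div_iff₀ (hw x)]
      refine le_trans ?_ hf
      exact Finset.single_le_sum (f := fun x => (f x - θ x) ^ 2 * w x)
        (fun y _ => mul_nonneg (sq_nonneg _) (hw y).le) (Finset.mem_univ x)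
    constructor <;> intro x <;> have := abs_le.1 (key x) <;> simp only <;> linarith
  have hK : IsCompact ({f : X → ℝ | Monotone f} ∩ {f | weightedSq w θ f ≤ C}) :=
    (isCompact_Icc).of_isClosed_subset
      (hclosed.inter (isClosed_le hcont continuous_const)) (fun f hf => hsub f hf.2)
  obtain ⟨f, hf, hmin⟩ := hK.exists_isMinOn
    ⟨0, fun _ _ _ => le_rfl, (le_refl C : weightedSq w θ 0 ≤ C)⟩ hcont.continuousOn
  have hfreg : IsIsotonicRegression w θ f := by
    refine ⟨hf.1, fun h hh => ?_⟩
    by_cases hhC : weightedSq w θ h ≤ C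
    · exact hmin ⟨hh, hhC⟩
    · exact le_trans hf.2 (not_le.1 hhC).le
  refine ⟨f, hfreg, fun h hh => ?_⟩
  have hmid : Monotone (fun x => (f x + h x) / 2) := fun x y hxy => by
    have h1 := hf.1 hxy
    have h2 := hh.1 hxy
    simp only
    linarith
  have h1 := hfreg.2 _ hmid
  have h2 := hh.2 _ hmid
  have hid : weightedSq w θ (fun x => (f x + h x) / 2) =
      (weightedSq w θ f + weightedSq w θ h) / 2 - ∑ x, (f x - h x) ^ 2 * w x / 4 := by
    unfold weightedSq
    rw [← Finset.sum_add_distrib, Finset.sum_div, ← Finset.sum_sub_distrib]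
    exact Finset.sum_congr rfl fun x _ => by ring
  have hz : ∑ x, (f x - h x) ^ 2 * w x / 4 ≤ 0 := by linarith
  have hnn : ∀ x ∈ Finset.univ, 0 ≤ (f x - h x) ^ 2 * w x / 4 := fun x _ =>
    div_nonneg (mul_nonneg (sq_nonneg _) (hw x).le) (by norm_num)
  have hzero := (Finset.sum_eq_zero_iff_of_nonneg hnn).1 (le_antisymm hz (Finset.sum_nonneg hnn))
  funext x
  have hx := hzero x (Finset.mem_univ x)
  have : (f x - h x) ^ 2 = 0 := by
    have := (hw x).ne'
    simpa [this] using hx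
  have := pow_eq_zero_iff (two_ne_zero) |>.1 this
  linarith

open Classical in
/-- The isotonic regression `θ^{*w}` as an operator (for positive weights it is the unique
minimiser; the value `0` is used only if there is no minimiser). -/
noncomputable def isoReg {X : Type*} [Fintype X] [Preorder X] (w θ : X → ℝ) : X → ℝ :=
  if h : ∃ f, IsIsotonicRegression w θ f then h.choose else 0

theorem isoReg_spec {X : Type*} [Fintype X] [Preorder X] (w θ : X → ℝ) (hw : ∀ x, 0 < w x) :
    IsIsotonicRegression w θ (isoReg w θ) := by
  have h := (existsUnique_isIsotonicRegression w θ hw).exists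
  unfold isoReg
  rw [dif_pos h]
  exact h.choose_spec

/-- The comparable level set of `g` that contains `x`: the connected component of `x` in the graph
which joins two points when they are comparable and lie in the same level set of `g`. -/
def comparableLevelSet {X : Type*} [Preorder X] (g : X → ℝ) (x : X) : Set X :=
  {y | Relation.EqvGen (fun a b => g a = g b ∧ (a ≤ b ∨ b ≤ a)) x y}

theorem mem_comparableLevelSet_self {X : Type*} [Preorder X] (g : X → ℝ) (x : X) :
    x ∈ comparableLevelSet g x :=
  Relation.EqvGen.refl x

noncomputable instance comparableLevelSet.instFintype {X : Type*} [Fintype X] [Preorder X]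
    (g : X → ℝ) (x : X) : Fintype (comparableLevelSet g x) :=
  Fintype.ofFinite _

/-- The operator `φ^w` attached to the function `g`: the concatenation of the isotonic regressions,
with weights `w`, of the restrictions of `θ` to the comparable level sets of `g`. -/
noncomputable def levelIsoReg {X : Type*} [Fintype X] [Preorder X] (g w θ : X → ℝ) : X → ℝ :=
  fun x => isoReg (fun y : comparableLevelSet g x => w y) (fun y : comparableLevelSet g x => θ y)
    ⟨x, mem_comparableLevelSet_self g x⟩

/-- Number of the first `n` design points that are equal to `p`. -/
def designCount {X : Type*} [DecidableEq X] (x : ℕ → X) (n : ℕ) (p : X) : ℕ :=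
  ((Finset.range n).filter (fun i => x i = p)).card

/-- Design frequencies `w^(n)`. -/
noncomputable def designFreq {X : Type*} [DecidableEq X] (x : ℕ → X) (n : ℕ) (p : X) : ℝ :=
  (designCount x n p : ℝ) / n

/-- Average of the first `n` responses over the design element `p` (zero if `p` has not occurred
yet; then the weight of `p` is zero too). -/
noncomputable def cellAverage {X : Type*} [DecidableEq X] (x : ℕ → X) (y : ℕ → ℝ) (n : ℕ)
    (p : X) : ℝ :=
  (∑ i ∈ (Finset.range n).filter (fun i => x i = p), y i) / (designCount x n p : ℝ)

/-! The rescaled error is, with probability tending to one, exactly a continuous function of the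
rescaled noise. Distinct values of `g` are separated by a gap, so a perturbation whose level-wise
regression is small enough leaves no order constraint active between different values of `g`. The
problem then splits over the comparable level sets, on each of which `g` is a constant that can be
subtracted (`isIsotonicRegression_add_levelIsoReg`).

The noise in a cell is a normalised sum of i.i.d. errors. As the design is deterministic, the cells
are independent and the scalar central limit theorem applies in each
(`tendstoInDistribution_normalizedCellSum`). Regression is jointly continuous in weights and data
(`tendsto_isotonicRegression`), so Slutsky and continuous mapping give the limit of the level-wise
regressions. This limit also makes them, divided by `√n`, vanish in probability, so the exact
identity applies. -/

/-! ### Continuity of isotonic regression -/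

/-- A minimiser over the isotonic functions stays close to the data, as `0` is isotonic. -/
theorem IsIsotonicRegression.abs_sub_le {X : Type*} [Fintype X] [Preorder X] {w θ f : X → ℝ}
    (hw : ∀ x, 0 < w x) (hf : IsIsotonicRegression w θ f) (x : X) :
    |f x - θ x| ≤ √(weightedSq w θ 0 / w x) := by
  apply Real.abs_le_sqrt
  rw [le_div_iff₀ (hw x)]
  exact (Finset.single_le_sum (f := fun x => (f x - θ x) ^ 2 * w x)
    (fun y _ => mul_nonneg (sq_nonneg _) (hw y).le) (Finset.mem_univ x)).trans
    (hf.2 0 fun _ _ _ => le_rfl)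

theorem Filter.Tendsto.weightedSq {X ι : Type*} [Fintype X] {l : Filter ι} {w θ f : ι → X → ℝ}
    {w₀ θ₀ f₀ : X → ℝ} (hw : Tendsto w l (𝓝 w₀)) (hθ : Tendsto θ l (𝓝 θ₀))
    (hf : Tendsto f l (𝓝 f₀)) :
    Tendsto (fun i => weightedSq (w i) (θ i) (f i)) l (𝓝 (weightedSq w₀ θ₀ f₀)) := by
  rw [tendsto_pi_nhds] at hw hθ hf
  exact tendsto_finsetSum _ fun x _ => (((hf x).sub (hθ x)).pow 2).mul (hw x)

/-- Isotonic regression is jointly continuous in the weights and the data, at positive weights. -/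
theorem tendsto_isotonicRegression {X ι : Type*} [Fintype X] [Preorder X] {l : Filter ι}
    {w θ f : ι → X → ℝ} {w₀ θ₀ f₀ : X → ℝ} (hw₀ : ∀ x, 0 < w₀ x)
    (hw : Tendsto w l (𝓝 w₀)) (hθ : Tendsto θ l (𝓝 θ₀))
    (hf : ∀ᶠ i in l, IsIsotonicRegression (w i) (θ i) (f i))
    (hf₀ : IsIsotonicRegression w₀ θ₀ f₀) : Tendsto f l (𝓝 f₀) := by
  have hwx := tendsto_pi_nhds.1 hw
  have hθx := tendsto_pi_nhds.1 hθ
  have hwpos : ∀ᶠ i in l, ∀ x, 0 < w i x :=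
    eventually_all.2 fun x => (hwx x).eventually_const_lt (hw₀ x)
  have hC : Tendsto (fun i => weightedSq (w i) (θ i) 0) l (𝓝 (weightedSq w₀ θ₀ 0)) :=
    hw.weightedSq hθ tendsto_const_nhds
  have hR : ∀ x, Tendsto (fun i => |θ i x| + √(weightedSq (w i) (θ i) 0 / w i x)) l
      (𝓝 (|θ₀ x| + √(weightedSq w₀ θ₀ 0 / w₀ x))) := fun x =>
    (hθx x).abs.add (hC.div (hwx x) (hw₀ x).ne').sqrt
  set R : X → ℝ := fun x => |θ₀ x| + √(weightedSq w₀ θ₀ 0 / w₀ x) + 1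
  have hbound : ∀ᶠ i in l, f i ∈ Set.Icc (-R) R := by
    have hlt : ∀ᶠ i in l, ∀ x, |θ i x| + √(weightedSq (w i) (θ i) 0 / w i x) < R x :=
      eventually_all.2 fun x => (hR x).eventually_lt_const (lt_add_one _)
    filter_upwards [hwpos, hf, hlt] with i hi hfi hlti
    have habs : ∀ x, |f i x| ≤ R x := fun x => by
      have h1 := hfi.abs_sub_le hi x
      have h2 := abs_sub_abs_le_abs_sub (f i x) (θ i x)
      linarith [hlti x]
    exact ⟨fun x => (abs_le.1 (habs x)).1, fun x => (abs_le.1 (habs x)).2⟩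
  -- Isotonicity and minimality are closed conditions, so every cluster point is a regression for
  -- the limit data; uniqueness identifies it with `f₀`.
  refine isCompact_Icc.tendsto_nhds_of_unique_mapClusterPt hbound fun f₁ _ hf₁ => ?_
  obtain ⟨U, hUl, hU⟩ := mapClusterPt_iff_ultrafilter.1 hf₁
  refine (existsUnique_isIsotonicRegression w₀ θ₀ hw₀).unique ⟨fun x y hxy => ?_, fun h hh => ?_⟩ hf₀
  · refine le_of_tendsto_of_tendsto (tendsto_pi_nhds.1 hU x) (tendsto_pi_nhds.1 hU y) ?_
    filter_upwards [hUl hf] with i hi using hi.1 hxy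
  · refine le_of_tendsto_of_tendsto
      ((hw.mono_left hUl).weightedSq (hθ.mono_left hUl) hU)
      ((hw.mono_left hUl).weightedSq (hθ.mono_left hUl) tendsto_const_nhds) ?_
    filter_upwards [hUl hf] with i hi using hi.2 h hh

theorem Continuous.isoReg {X T : Type*} [Fintype X] [Preorder X] [TopologicalSpace T]
    {w θ : T → X → ℝ} (hw : Continuous w) (hθ : Continuous θ) (hpos : ∀ t x, 0 < w t x) :
    Continuous fun t => isoReg (w t) (θ t) :=
  continuous_iff_continuousAt.2 fun t => tendsto_isotonicRegression (hpos t) (hw.tendsto t)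
    (hθ.tendsto t) (.of_forall fun s => isoReg_spec _ _ (hpos s)) (isoReg_spec _ _ (hpos t))

theorem Continuous.levelIsoReg {X T : Type*} [Fintype X] [Preorder X] [TopologicalSpace T]
    (g : X → ℝ) {w θ : T → X → ℝ} (hw : Continuous w) (hθ : Continuous θ)
    (hpos : ∀ t x, 0 < w t x) : Continuous fun t => levelIsoReg g (w t) (θ t) := by
  refine continuous_pi fun x => ?_
  have := Continuous.isoReg (X := comparableLevelSet g x) (w := fun t y => w t y)
    (θ := fun t y => θ t y) (by fun_prop) (by fun_prop) fun t y => hpos t y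
  exact (continuous_apply _).comp this

/-! ### Localisation to comparable level sets -/

section LevelSets

variable {X : Type*} [Preorder X] {g w θ : X → ℝ}

theorem comparableLevelSet_eq {x y : X} (h : y ∈ comparableLevelSet g x) :
    comparableLevelSet g y = comparableLevelSet g x := by
  ext z
  exact ⟨fun hz => h.trans _ _ _ hz, fun hz => (h.symm _ _).trans _ _ _ hz⟩

theorem eq_of_mem_comparableLevelSet {x y : X} (h : y ∈ comparableLevelSet g x) : g x = g y := by
  induction h with
  | rel _ _ h => exact h.1
  | refl => rfl
  | symm _ _ _ ih => exact ih.symm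
  | trans _ _ _ _ _ ih₁ ih₂ => exact ih₁.trans ih₂

theorem mem_comparableLevelSet_of_le {x y : X} (hxy : x ≤ y) (h : g x = g y) :
    y ∈ comparableLevelSet g x :=
  .rel _ _ ⟨h, .inl hxy⟩

/-- Points of one level set define equal sets, but different subtypes with unrelated `Fintype`
instances; this bridges them. -/
theorem isoReg_subtype_congr {S T : Set X} [Fintype S] [Fintype T] (h : S = T) {y : X}
    (hS : y ∈ S) (hT : y ∈ T) :
    isoReg (fun z : S => w z) (fun z : S => θ z) ⟨y, hS⟩ =
      isoReg (fun z : T => w z) (fun z : T => θ z) ⟨y, hT⟩ := by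
  subst h
  congr!

variable [Fintype X]

/-- On each comparable level set, `levelIsoReg` is the isotonic regression over that set. -/
theorem isIsotonicRegression_levelIsoReg (hw : ∀ x, 0 < w x) (x : X) :
    IsIsotonicRegression (fun y : comparableLevelSet g x => w y)
      (fun y : comparableLevelSet g x => θ y)
      (fun y : comparableLevelSet g x => levelIsoReg g w θ y) := by
  have h : (fun y : comparableLevelSet g x => levelIsoReg g w θ y) =
      isoReg (fun y : comparableLevelSet g x => w y)
        (fun y : comparableLevelSet g x => θ y) :=
    funext fun y => isoReg_subtype_congr (comparableLevelSet_eq y.2) _ _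
  rw [h]
  exact isoReg_spec _ _ fun y => hw y

-- The comparable level sets partition `X`, so minimality may be checked on each separately.
open Classical in
theorem sum_le_sum_of_comparableLevelSet {F H : X → ℝ}
    (h : ∀ x, ∑ y : comparableLevelSet g x, F y ≤ ∑ y : comparableLevelSet g x, H y) :
    ∑ x, F x ≤ ∑ x, H x := by
  have hmaps : ∀ x ∈ Finset.univ,
      comparableLevelSet g x ∈ Finset.univ.image (comparableLevelSet g) :=
    fun x hx => Finset.mem_image_of_mem _ hx
  rw [← Finset.sum_fiberwise_of_maps_to hmaps F, ← Finset.sum_fiberwise_of_maps_to hmaps H]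
  refine Finset.sum_le_sum fun S hS => ?_
  obtain ⟨x, -, rfl⟩ := Finset.mem_image.1 hS
  have hmem : ∀ y, y ∈ Finset.univ.filter
      (fun y => comparableLevelSet g y = comparableLevelSet g x) ↔ y ∈ comparableLevelSet g x := by
    intro y
    simp only [Finset.mem_filter_univ]
    exact ⟨fun hy => hy ▸ mem_comparableLevelSet_self g y, comparableLevelSet_eq⟩
  rw [Finset.sum_subtype _ hmem F, Finset.sum_subtype _ hmem H]
  exact h x

/-- A small perturbation of an isotonic `g` is regressed level set by level set. -/
theorem isIsotonicRegression_add_levelIsoReg (hg : Monotone g) (hw : ∀ x, 0 < w x) {s c : ℝ}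
    (hs : 0 < s) (hgap : ∀ x y, g x < g y → 2 * c ≤ g y - g x)
    (hc : ∀ x, |s * levelIsoReg g w θ x| ≤ c) :
    IsIsotonicRegression w (fun x => g x + s * θ x) (fun x => g x + s * levelIsoReg g w θ x) := by
  refine ⟨fun x y hxy => ?_, fun h hh => ?_⟩
  -- Comparable points with equal `g` share a level set; otherwise the jump `2 * c` absorbs two
  -- perturbations of size at most `c`.
  · rcases (hg hxy).eq_or_lt with he | hlt
    · have hmono : levelIsoReg g w θ x ≤ levelIsoReg g w θ y :=
        @(isIsotonicRegression_levelIsoReg (g := g) (θ := θ) hw x).1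
          ⟨x, mem_comparableLevelSet_self g x⟩ ⟨y, mem_comparableLevelSet_of_le hxy he⟩ hxy
      have := mul_le_mul_of_nonneg_left hmono hs.le
      simp only
      linarith
    · have h1 := abs_le.1 (hc x)
      have h2 := abs_le.1 (hc y)
      have := hgap x y hlt
      simp only
      linarith
  · refine sum_le_sum_of_comparableLevelSet (g := g) fun x => ?_
    -- As `g` is constant on the level set, a rescaled competitor stays isotonic there; the factor
    -- `s ^ 2` restores the original criterion.
    have hmono : Monotone fun y : comparableLevelSet g x => (h y - g y) / s := fun y z hyz => by
      have h1 := hh (show (y : X) ≤ z from hyz)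
      have h2 := eq_of_mem_comparableLevelSet y.2
      have h3 := eq_of_mem_comparableLevelSet z.2
      simp only
      gcongr
      linarith
    have hmin := mul_le_mul_of_nonneg_left
      ((isIsotonicRegression_levelIsoReg (g := g) (θ := θ) hw x).2 _ hmono) (sq_nonneg s)
    simp only [weightedSq, Finset.mul_sum] at hmin
    convert! hmin using 2 with y _ y _
    · ring
    · field_simp
      ring

end LevelSets

/-! ### Central limit theorem for the cells -/

section CellSums

variable {X : Type*} [DecidableEq X]

/-- Sum over the cell `p` of the first `n` responses, normalised by the root of its size. -/
noncomputable def normalizedCellSum (x : ℕ → X) (y : ℕ → ℝ) (n : ℕ) (p : X) : ℝ :=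
  (√(designCount x n p))⁻¹ * ∑ i ∈ (Finset.range n).filter (fun i => x i = p), y i

theorem tendsto_designCount {x : ℕ → X} {w : X → ℝ} {p : X} (hw : 0 < w p)
    (h : Tendsto (fun n => designFreq x n p) atTop (𝓝 (w p))) :
    Tendsto (fun n => designCount x n p) atTop atTop := by
  rw [← tendsto_natCast_atTop_iff (R := ℝ)]
  refine (h.pos_mul_atTop hw tendsto_natCast_atTop_atTop).congr' ?_
  filter_upwards [eventually_ne_atTop 0] with n hn
  have : (n : ℝ) ≠ 0 := by exact_mod_cast hn
  simp [designFreq, this]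

variable [Fintype X] {Ω : Type*} [MeasurableSpace Ω] {P : Measure Ω} {ε : ℕ → Ω → ℝ}

theorem aemeasurable_normalizedCellSum (x : ℕ → X) (hε : ∀ i, AEMeasurable (ε i) P) (n : ℕ) :
    AEMeasurable (fun ω => normalizedCellSum x (fun i => ε i ω) n) P :=
  aemeasurable_pi_lambda _ fun _ =>
    .const_mul (Finset.aemeasurable_fun_sum _ fun _ _ => hε _) _

theorem charFun_normalizedCellSum (x : ℕ → X) (hindep : iIndepFun ε P)
    (hident : ∀ i, IdentDistrib (ε i) (ε 0) P P) (n : ℕ) (t : EuclideanSpace ℝ X) :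
    charFun (P.map fun ω => WithLp.toLp 2 (normalizedCellSum x (fun i => ε i ω) n)) t =
      ∏ p, charFun (P.map (ε 0)) ((√(designCount x n p))⁻¹ * t p) ^ designCount x n p := by
  have hm i := (hident i).aemeasurable_fst
  set c : ℕ → ℝ := fun i => (√(designCount x n (x i)))⁻¹ * t (x i)
  -- Pairing with `t` turns the vector into one weighted sum of independent errors, whose
  -- characteristic function factorises.
  have hinner (ω : Ω) :
      inner ℝ (WithLp.toLp 2 (normalizedCellSum x (fun i => ε i ω) n)) t =
        inner ℝ (∑ i ∈ Finset.range n, c i * ε i ω) 1 := by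
    simp only [PiLp.inner_apply, normalizedCellSum, RCLike.inner_apply, conj_trivial, one_mul]
    rw [← Finset.sum_fiberwise (Finset.range n) x]
    refine Finset.sum_congr rfl fun p _ => ?_
    rw [Finset.mul_sum, Finset.mul_sum]
    refine Finset.sum_congr rfl fun i hi => ?_
    rw [← (Finset.mem_filter.1 hi).2]
    ring
  have hV : AEMeasurable (fun ω => WithLp.toLp 2 (normalizedCellSum x (fun i => ε i ω) n)) P :=
    (WithLp.measurable_toLp 2 _).comp_aemeasurable (aemeasurable_normalizedCellSum x hm n)
  have hS : AEMeasurable (fun ω => ∑ i ∈ Finset.range n, c i * ε i ω) P :=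
    Finset.aemeasurable_fun_sum _ fun i _ => (hm i).const_mul _
  have hind : iIndepFun (fun i ω => c i * ε i ω) P :=
    hindep.comp (fun i u => c i * u) fun i => by fun_prop
  calc
    _ = charFun (P.map fun ω => ∑ i ∈ Finset.range n, c i * ε i ω) 1 := by
      rw [charFun_apply, charFun_apply, integral_map hV (by fun_prop),
        integral_map hS (by fun_prop)]
      simp_rw [hinner]
    _ = ∏ i ∈ Finset.range n, charFun (P.map (ε 0)) (c i) := by
      rw [(hind.restrict _).charFun_map_fun_finsetSum_eq_prod fun i _ => (hm i).const_mul _,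
        Finset.prod_apply]
      refine Finset.prod_congr rfl fun i _ => ?_
      rw [charFun_map_mul_comp (hm i), mul_one, (hident i).map_eq]
    _ = _ := by
      rw [← Finset.prod_fiberwise (Finset.range n) x]
      refine Finset.prod_congr rfl fun p _ => ?_
      rw [designCount, ← Finset.prod_const]
      refine Finset.prod_congr rfl fun i hi => ?_
      simp only [c, (Finset.mem_filter.1 hi).2, designCount]

/-- The scalar central limit theorem in terms of characteristic functions. -/
theorem tendsto_charFun_pow [IsProbabilityMeasure P] {σ : ℝ} (hindep : iIndepFun ε P)
    (hident : ∀ i, IdentDistrib (ε i) (ε 0) P P) (hL2 : MemLp (ε 0) 2 P)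
    (hmean : ∫ ω, ε 0 ω ∂P = 0) (hvar : variance (ε 0) P = σ ^ 2) (t : ℝ) :
    Tendsto (fun n : ℕ => charFun (P.map (ε 0)) ((√n)⁻¹ * t) ^ n) atTop
      (𝓝 (Complex.exp (-(σ ^ 2 * t ^ 2 / 2 : ℝ)))) := by
  have hlaw : HasLaw (id : ℝ → ℝ) (gaussianReal 0 (variance (ε 0) P).toNNReal)
      (gaussianReal 0 (variance (ε 0) P).toNNReal) := ⟨aemeasurable_id, Measure.map_id⟩
  have h := ProbabilityMeasure.tendsto_iff_tendsto_charFun.1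
    (tendstoInDistribution_inv_sqrt_mul_sum_sub hlaw hL2 hindep hident).tendsto t
  simp only [ProbabilityMeasure.coe_mk, hmean, mul_zero, sub_zero,
    charFun_inv_sqrt_mul_sum hindep hident, Measure.map_id, charFun_gaussianReal] at h
  convert! h using 2
  simp [hvar, Real.coe_toNNReal _ (sq_nonneg σ)]

/-- The factor `√(w p)` cancels the `1 / w p` in the covariance, leaving independent coordinates of
variance `σ ^ 2`. -/
theorem charFun_sqrt_mul_gaussian {Ω' : Type*} [MeasurableSpace Ω'] {P' : Measure Ω'} {σ : ℝ}
    {w : X → ℝ} (hw : ∀ p, 0 < w p) {G : Ω' → EuclideanSpace ℝ X}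
    (hG : HasLaw G (multivariateGaussian 0 (Matrix.diagonal fun p => σ ^ 2 / w p)) P')
    (t : EuclideanSpace ℝ X) :
    charFun (P'.map fun ω => WithLp.toLp 2 fun p => √(w p) * G ω p) t =
      ∏ p, Complex.exp (-(σ ^ 2 * t p ^ 2 / 2 : ℝ)) := by
  have hS : (Matrix.diagonal fun p => σ ^ 2 / w p).PosSemidef :=
    Matrix.PosSemidef.diagonal fun p => div_nonneg (sq_nonneg σ) (hw p).le
  have hmG := hG.aemeasurable
  have hm : AEMeasurable (fun ω => WithLp.toLp 2 fun p => √(w p) * G ω p) P' := by fun_prop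
  have hinner (ω : Ω') : inner ℝ (WithLp.toLp 2 fun p => √(w p) * G ω p) t =
      inner ℝ (G ω) (WithLp.toLp 2 fun p => √(w p) * t p) := by
    simp only [PiLp.inner_apply, RCLike.inner_apply, conj_trivial]
    exact Finset.sum_congr rfl fun p _ => by ring
  calc
    _ = charFun (P'.map G) (WithLp.toLp 2 fun p => √(w p) * t p) := by
      rw [charFun_apply, charFun_apply, integral_map hm (by fun_prop),
        integral_map hmG (by fun_prop)]
      simp_rw [hinner]
    _ = _ := by
      rw [hG.map_eq, charFun_multivariateGaussian hS, ← Complex.exp_sum]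
      congr 1
      simp only [inner_zero_right, Complex.ofReal_zero, zero_mul, zero_sub, dotProduct,
        Matrix.mulVec_diagonal, Finset.sum_neg_distrib, ← Complex.ofReal_sum]
      rw [← Finset.sum_div]
      push_cast
      congr 2
      refine Finset.sum_congr rfl fun p _ => ?_
      have h1 : √(w p) * t p * (σ ^ 2 / w p * (√(w p) * t p)) = σ ^ 2 * t p ^ 2 := by
        have := (hw p).ne'
        have h2 := Real.mul_self_sqrt (hw p).le
        field_simp
        rw [Real.sq_sqrt (hw p).le]
        ring
      exact_mod_cast h1

/-- Central limit theorem for the normalised cell sums. -/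
theorem tendstoInDistribution_normalizedCellSum [IsProbabilityMeasure P]
    {Ω' : Type*} [MeasurableSpace Ω'] {P' : Measure Ω'} [IsProbabilityMeasure P']
    {x : ℕ → X} {σ : ℝ} (hindep : iIndepFun ε P) (hident : ∀ i, IdentDistrib (ε i) (ε 0) P P)
    (hL2 : MemLp (ε 0) 2 P) (hmean : ∫ ω, ε 0 ω ∂P = 0) (hvar : variance (ε 0) P = σ ^ 2)
    {w : X → ℝ} (hw : ∀ p, 0 < w p) (hdesign : Tendsto (fun n => designFreq x n) atTop (𝓝 w))
    {G : Ω' → EuclideanSpace ℝ X}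
    (hG : HasLaw G (multivariateGaussian 0 (Matrix.diagonal fun p => σ ^ 2 / w p)) P') :
    TendstoInDistribution
      (fun n ω => WithLp.toLp 2 (normalizedCellSum x (fun i => ε i ω) n)) atTop
      (fun ω => WithLp.toLp 2 fun p => √(w p) * G ω p) (fun _ => P) P' where
  forall_aemeasurable n := (WithLp.measurable_toLp 2 _).comp_aemeasurable
    (aemeasurable_normalizedCellSum x (fun i => (hident i).aemeasurable_fst) n)
  aemeasurable_limit := by
    have := hG.aemeasurable
    fun_prop
  tendsto := by
    refine ProbabilityMeasure.tendsto_iff_tendsto_charFun.2 fun t => ?_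
    simp only [ProbabilityMeasure.coe_mk, charFun_normalizedCellSum x hindep hident,
      charFun_sqrt_mul_gaussian hw hG]
    exact tendsto_finsetProd _ fun p _ =>
      (tendsto_charFun_pow hindep hident hL2 hmean hvar (t p)).comp
        (tendsto_designCount (hw p) (tendsto_pi_nhds.1 hdesign p))

end CellSums

/-! ### Negligible terms and the gap -/

/-- A sequence that converges in distribution, multiplied by factors that tend to zero, tends to
zero in probability. -/
theorem MeasureTheory.TendstoInDistribution.smul_tendstoInMeasure_zero {ι E Ω Ω' : Type*}
    [MeasurableSpace Ω] [MeasurableSpace Ω'] {P : Measure Ω} [IsProbabilityMeasure P]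
    {P' : Measure Ω'} [IsProbabilityMeasure P'] [NormedAddCommGroup E] [NormedSpace ℝ E]
    [SecondCountableTopology E] [MeasurableSpace E] [BorelSpace E] {l : Filter ι}
    [l.IsCountablyGenerated] {U : ι → Ω → E} {Z : Ω' → E} {s : ι → ℝ}
    (hU : TendstoInDistribution U l Z (fun _ => P) P') (hs : Tendsto s l (𝓝 0)) :
    TendstoInMeasure P (fun i ω => s i • U i ω) l 0 := by
  have hsm : TendstoInMeasure P (fun i (_ : Ω) => s i) l fun _ => (0 : ℝ) := by
    refine tendstoInMeasure_iff_norm.2 fun δ hδ => tendsto_const_nhds.congr' ?_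
    filter_upwards [Metric.tendsto_nhds.1 hs δ hδ] with i hi
    rw [Real.dist_0_eq_abs] at hi
    simp [hi.not_ge]
  have h := hU.continuous_comp_prodMk_of_tendstoInMeasure_const (g := fun p : E × ℝ => p.2 • p.1)
    (by fun_prop) hsm fun _ => aemeasurable_const
  -- The limit law is now the point mass at `0`; the portmanteau bound on a closed set avoiding `0`
  -- gives convergence in measure.
  refine tendstoInMeasure_iff_norm.2 fun δ hδ => ?_
  have hF : IsClosed {y : E | δ ≤ ‖y‖} := isClosed_le continuous_const continuous_norm
  have hle := ProbabilityMeasure.limsup_measure_closed_le_of_tendsto h.tendsto hF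
  simp only [ProbabilityMeasure.coe_mk, zero_smul] at hle
  rw [Measure.map_apply measurable_const hF.measurableSet] at hle
  simp only [Set.preimage_ofPred_eq, norm_zero, not_le.2 hδ, Set.ofPred_false, measure_empty] at hle
  refine tendsto_of_le_liminf_of_limsup_le bot_le (hle.trans' (limsup_le_limsup ?_))
  refine .of_forall fun i => ?_
  simp only [Pi.zero_apply, sub_zero]
  rw [Measure.map_apply_of_aemeasurable (h.forall_aemeasurable i) hF.measurableSet]
  rfl

/-- Distinct values of a function on a finite type are separated by a positive gap. -/
theorem exists_pos_gap {X : Type*} [Finite X] (g : X → ℝ) :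
    ∃ c > 0, ∀ x y, g x < g y → 2 * c ≤ g y - g x := by
  have h : ∀ᶠ c in 𝓝[>] (0 : ℝ), ∀ p : {p : X × X // g p.1 < g p.2},
      2 * c < g p.1.2 - g p.1.1 := by
    refine eventually_all.2 fun p => ?_
    have ht : Tendsto (fun c : ℝ => 2 * c) (𝓝[>] 0) (𝓝 0) :=
      ((continuous_const_mul (2 : ℝ)).tendsto' 0 0 (mul_zero 2)).mono_left nhdsWithin_le_nhds
    exact ht.eventually_lt_const (sub_pos.2 p.2)
  obtain ⟨c, hc, hpos⟩ := (h.and self_mem_nhdsWithin).exists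
  exact ⟨c, hpos, fun x y hxy => (hc ⟨(x, y), hxy⟩).le⟩

/-! ### The estimator and its limit -/

section Design

variable {X : Type*} [DecidableEq X]

/-- Since the count is `n` times the frequency, the rate `1 / √n` separates from noise of constant
order. -/
theorem cellAverage_eq (x : ℕ → X) (g : X → ℝ) (e : ℕ → ℝ) {n : ℕ} (hn : 0 < n) {p : X}
    (hp : 0 < designFreq x n p) :
    cellAverage x (fun i => g (x i) + e i) n p =
      g p + (√n)⁻¹ * (normalizedCellSum x e n p / √(designFreq x n p)) := by
  have hn' : (0 : ℝ) < n := by exact_mod_cast hn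
  have hN : (0 : ℝ) < designCount x n p := by
    by_contra h
    exact hp.not_ge (div_nonpos_of_nonpos_of_nonneg (not_lt.1 h) hn'.le)
  have hsum : ∑ i ∈ (Finset.range n).filter (fun i => x i = p), g (x i) =
      designCount x n p * g p := by
    rw [designCount, ← nsmul_eq_mul, ← Finset.sum_const]
    exact Finset.sum_congr rfl fun i hi => by rw [(Finset.mem_filter.1 hi).2]
  rw [cellAverage, Finset.sum_add_distrib, hsum, normalizedCellSum, designFreq,
    Real.sqrt_div hN.le]
  have h1 := Real.sqrt_pos.2 hn'
  have h2 := Real.sqrt_pos.2 hN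
  field_simp
  rw [Real.sq_sqrt hN.le]
  ring

variable [Fintype X] [Preorder X]

/-- When the level-wise regression `u` is small, the rescaled error of the estimator is `u`. -/
theorem eq_add_smul_levelIsoReg {g : X → ℝ} (hg : Monotone g) {c : ℝ}
    (hgap : ∀ x y, g x < g y → 2 * c ≤ g y - g x) (x : ℕ → X) (e : ℕ → ℝ) {n : ℕ} (hn : 0 < n)
    (hp : ∀ p, 0 < designFreq x n p) {f u : X → ℝ}
    (hu : u = levelIsoReg g (designFreq x n)
      fun p => normalizedCellSum x e n p / √(designFreq x n p))
    (hc : ‖(√(n : ℝ))⁻¹ • u‖ ≤ c)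
    (hf : IsIsotonicRegression (designFreq x n) (cellAverage x (fun i => g (x i) + e i) n) f) :
    √(n : ℝ) • (f - g) = u := by
  have hs : 0 < √(n : ℝ) := Real.sqrt_pos.2 (by exact_mod_cast hn)
  have havg : cellAverage x (fun i => g (x i) + e i) n = fun p =>
      g p + (√n)⁻¹ * (normalizedCellSum x e n p / √(designFreq x n p)) :=
    funext fun p => cellAverage_eq x g e hn (hp p)
  have h := (existsUnique_isIsotonicRegression _ _ hp).unique hf (havg ▸
    isIsotonicRegression_add_levelIsoReg hg hp (inv_pos.2 hs) hgap fun p => by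
      rw [← hu]
      exact (norm_le_pi_norm ((√(n : ℝ))⁻¹ • u) p).trans hc)
  rw [h, ← hu]
  funext p
  simp only [Pi.smul_apply, Pi.sub_apply, smul_eq_mul]
  field_simp
  ring

/-- The limit theorem for an arbitrary finite pre-ordered design space. -/
theorem tendstoInDistribution_isotonicRegression
    {Ω : Type*} [MeasurableSpace Ω] {P : Measure Ω} [IsProbabilityMeasure P]
    {Ω' : Type*} [MeasurableSpace Ω'] {P' : Measure Ω'} [IsProbabilityMeasure P']
    {g : X → ℝ} (hg : Monotone g) {x : ℕ → X} {ε : ℕ → Ω → ℝ} {σ : ℝ}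
    (hindep : iIndepFun ε P) (hident : ∀ i, IdentDistrib (ε i) (ε 0) P P)
    (hL2 : MemLp (ε 0) 2 P) (hmean : ∫ ω, ε 0 ω ∂P = 0) (hvar : variance (ε 0) P = σ ^ 2)
    {w : X → ℝ} (hw : ∀ p, 0 < w p) (hdesign : Tendsto (fun n => designFreq x n) atTop (𝓝 w))
    {f : ℕ → Ω → X → ℝ} (hmeas : ∀ n, AEMeasurable (f n) P)
    (hf : ∀ n, ∀ᵐ ω ∂P, IsIsotonicRegression (designFreq x n)
      (cellAverage x (fun i => g (x i) + ε i ω) n) (f n ω))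
    {G : Ω' → EuclideanSpace ℝ X}
    (hG : HasLaw G (multivariateGaussian 0 (Matrix.diagonal fun p => σ ^ 2 / w p)) P') :
    TendstoInDistribution (fun (n : ℕ) (ω : Ω) => √(n : ℝ) • (f n ω - g)) atTop
      (fun ω' => levelIsoReg g w (fun p => G ω' p)) (fun _ => P) P' := by
  -- Clamping the weights away from zero makes the limiting operator continuous everywhere.
  let clamp : (X → ℝ) → X → ℝ := fun v p => max (v p) (w p / 2)
  have hclamp_pos : ∀ v p, 0 < clamp v p := fun v p => lt_max_of_lt_right (half_pos (hw p))
  have hclamp_eq : ∀ v : X → ℝ, (∀ p, w p / 2 ≤ v p) → clamp v = v := fun v hv =>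
    funext fun p => max_eq_left (hv p)
  let H : EuclideanSpace ℝ X × (X → ℝ) → X → ℝ := fun q =>
    levelIsoReg g (clamp q.2) fun p => q.1 p / √(clamp q.2 p)
  have hH : Continuous H := by
    refine Continuous.levelIsoReg g (by fun_prop) (continuous_pi fun p => ?_)
      fun q p => hclamp_pos _ _
    exact Continuous.div (by fun_prop) (by fun_prop)
      fun q => (Real.sqrt_pos.2 (hclamp_pos _ _)).ne'
  let U : ℕ → Ω → X → ℝ := fun n ω =>
    H (WithLp.toLp 2 (normalizedCellSum x (fun i => ε i ω) n), designFreq x n)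
  have hfreq : TendstoInMeasure P (fun n (_ : Ω) => designFreq x n) atTop fun _ => w :=
    tendstoInMeasure_of_tendsto_ae (fun _ => aestronglyMeasurable_const)
      (.of_forall fun _ => hdesign)
  have hU : TendstoInDistribution U atTop (fun ω' => levelIsoReg g w (fun p => G ω' p))
      (fun _ => P) P' := by
    have h := (tendstoInDistribution_normalizedCellSum hindep hident hL2 hmean hvar hw hdesign
      hG).continuous_comp_prodMk_of_tendstoInMeasure_const hH hfreq fun _ => aemeasurable_const
    refine h.congr (fun _ => .rfl) (.of_forall fun ω' => ?_)
    -- The clamp is inactive at the limit weights, and dividing `√(w p) * G` by `√(w p)` returns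
    -- `G`.
    have hcw : clamp w = w := hclamp_eq w fun p => half_le_self (hw p).le
    simp only [H, hcw]
    congr 1
    funext p
    exact mul_div_cancel_left₀ _ (Real.sqrt_pos.2 (hw p)).ne'
  obtain ⟨c, hcpos, hgap⟩ := exists_pos_gap g
  have hinv : Tendsto (fun n : ℕ => (√(n : ℝ))⁻¹) atTop (𝓝 0) :=
    tendsto_inv_atTop_zero.comp (Real.tendsto_sqrt_atTop.comp tendsto_natCast_atTop_atTop)
  have hsmall := tendstoInMeasure_iff_norm.1 (hU.smul_tendstoInMeasure_zero hinv) c hcpos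
  refine tendstoInDistribution_of_tendstoInMeasure_sub _ _ hU ?_
    fun n => ((hmeas n).sub_const g).const_smul (√(n : ℝ))
  -- The difference from `U n` vanishes exactly unless `U n / √n` has norm at least `c`, so the
  -- bound is the same for every `δ`.
  refine tendstoInMeasure_iff_norm.2 fun δ hδ =>
    tendsto_of_tendsto_of_tendsto_of_le_of_le' tendsto_const_nhds hsmall
      (.of_forall fun _ => zero_le) ?_
  have hhalf : ∀ᶠ n in atTop, ∀ p, w p / 2 < designFreq x n p :=
    eventually_all.2 fun p =>
      (tendsto_pi_nhds.1 hdesign p).eventually_const_lt (half_lt_self (hw p))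
  filter_upwards [hhalf, eventually_gt_atTop 0] with n hn hn0
  refine measure_mono_ae ?_
  filter_upwards [hf n] with ω hω hlarge
  by_contra hlt
  have hlt' : ‖(√(n : ℝ))⁻¹ • U n ω‖ < c := by
    have := not_le.1 hlt
    simpa only [Pi.zero_apply, sub_zero] using this
  have heq : √(n : ℝ) • (f n ω - g) = U n ω := by
    refine eq_add_smul_levelIsoReg hg hgap x (fun i => ε i ω) hn0
      (fun p => (half_pos (hw p)).trans (hn p)) ?_ hlt'.le hω
    simp only [U, H, hclamp_eq _ fun p => (hn p).le]
  have hlarge' : δ ≤ ‖√(n : ℝ) • (f n ω - g) - U n ω - 0‖ := hlarge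
  rw [heq, sub_self, sub_zero, norm_zero] at hlarge'
  exact hδ.not_ge hlarge'

end Design

/-- The order on the grid `Fin r₁ × Fin r₂` is the componentwise one, so `Monotone` on it means
bimonotone increasing. The design points and the responses are indexed from `0`. -/
theorem theorem5p1 {r₁ r₂ : ℕ}
    {Ω : Type*} [MeasurableSpace Ω] (P : Measure Ω) [IsProbabilityMeasure P]
    {Ω' : Type*} [MeasurableSpace Ω'] (P' : Measure Ω') [IsProbabilityMeasure P']
    -- the regression function and the regression model
    (g : Fin r₁ × Fin r₂ → ℝ) (hg : Monotone g)
    (x : ℕ → Fin r₁ × Fin r₂) (ε Y : ℕ → Ω → ℝ) (σ : ℝ)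
    (hY : ∀ i ω, Y i ω = g (x i) + ε i ω)
    (hindep : iIndepFun ε P)
    (hident : ∀ i, IdentDistrib (ε i) (ε 0) P P)
    (hL2 : MemLp (ε 0) 2 P)
    (hmean : ∫ ω, ε 0 ω ∂P = 0)
    (hvar : variance (ε 0) P = σ ^ 2)
    -- the condition on the design
    (w : Fin r₁ × Fin r₂ → ℝ) (hw : ∀ p, 0 < w p)
    (hdesign : Tendsto (fun n => designFreq x n) atTop (𝓝 w))
    -- the least squares estimator under the bimonotonicity constraint
    (gstar : ℕ → Ω → Fin r₁ × Fin r₂ → ℝ)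
    (hmeas : ∀ n, AEMeasurable (gstar n) P)
    (hgstar : ∀ n, ∀ᵐ ω ∂P, IsIsotonicRegression (designFreq x n)
      (cellAverage x (fun i => Y i ω) n) (gstar n ω))
    -- the Gaussian vector with mean zero and diagonal covariance matrix
    (G : Ω' → EuclideanSpace ℝ (Fin r₁ × Fin r₂))
    (hG : HasLaw G (multivariateGaussian 0 (Matrix.diagonal fun p => σ ^ 2 / w p)) P') :
    TendstoInDistribution (fun (n : ℕ) (ω : Ω) => √(n : ℝ) • (gstar n ω - g)) atTop
      (fun ω' => levelIsoReg g w (fun p => G ω' p)) (fun _ => P) P' := by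
  simp only [hY] at hgstar
  exact tendstoInDistribution_isotonicRegression hg hindep hident hL2 hmean hvar hw hdesign hmeas
    hgstar hG
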